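/- Let $\kappa$ be an infinite cardinal, identified with the set of ordinals below its initial ordinal. For $x,\alpha\in\kappa$ put $$B(x,\alpha)=\{y\in\kappa: x\le y\le x+\alpha\}\cup\{y\in\kappa: y\le x\le y+\alpha\},$$ and for $A\subseteq\kappa$ put $B(A,\alpha)=\bigcup_{a\in A}B(a,\alpha)$. The cardinal ballean $\overleftrightarrow{\kappa}$ is the ballean with support $\kappa$, set of radii $\kappa$ and balls $B(x,\alpha)$. A subset $A\subseteq\kappa$ is called bounded if $A\subseteq B(x,\alpha)$ for some $x,\alpha\in\kappa$; large if $B(A,\alpha)=\kappa$ for some $\alpha\in\kappa$; small if $\kappa\setminus B(A,\alpha)$ is large for every $\alpha\in\kappa$; thick if for every $\alpha\in\kappa$ there is $a\in A$ with $B(a,\alpha)\subseteq A$; thin if for every $\alpha\in\kappa$ there is a bounded set $V$ such that $B(a,\alpha)\cap B(a',\alpha)=\varnothing$ for all distinct $a,a'\in A\setminus V$. Define - $den\,\overleftrightarrow{\kappa}$ as the minimal cardinality of a large subset of $\kappa$; - $spread\,\overleftrightarrow{\kappa}$ as the supremum, over the thin subsets $Y$ of $\kappa$, of $\min\{|Y\setminus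 V|: V\text{ bounded}\}$; - $res\,\overleftrightarrow{\kappa}$ (respectively $thick\,\overleftrightarrow{\kappa}$) as the supremum of the cardinalities of the families of pairwise disjoint large (respectively thick) subsets of $\kappa$; - $cores\,\overleftrightarrow{\kappa}$ (respectively $thin\,\overleftrightarrow{\kappa}$) as the minimal cardinality of a covering of $\kappa$ by small (respectively thin) subsets. Then the following statements hold: (i) $den\,\overleftrightarrow{\kappa}=spread\,\overleftrightarrow{\kappa}=\kappa$; (ii) $res\,\overleftrightarrow{\kappa}=\kappa$, and $\kappa$ can be partitioned into $\kappa$ large subsets; (iii) $cores\,\overleftrightarrow{\kappa}=\aleph_0$; (iv) $thick\,\overleftrightarrow{\kappa}=\kappa$, and $\kappa$ can be partitioned into $\kappa$ thick subsets; (v) $thin\,\overleftrightarrow{\kappa}=\mathrm{cf}\,\kappa$ if $\kappa$ is a limit cardinal (including $\kappa=\aleph_0$), and $thin\,\overleftrightarrow{\kappa^+}=\kappa$, where $\kappa^+$ is the successor cardinal of $\kappa$ and $thin\,\overleftrightarrow{\kappa^+}$ is defined in the same way with $\kappa^+$ in place of $\kappa$. -/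

import Mathlib

open Cardinal

universe u v

/-- A ballean with support `X` and set of radii `P`. -/
structure Ballean (X : Type u) (P : Type v) where
  /-- the ball of radius `α` around `x` -/
  ball : X → P → Set X
  nonempty_support : Nonempty X
  nonempty_radii : Nonempty P
  mem_ball : ∀ x α, x ∈ ball x α
  /-- Here `{y | x ∈ ball y α}` is the dual ball `B*(x, α)`. -/
  symm_ball : ∀ α β : P, ∃ α' β' : P, ∀ x : X,
    ball x α ⊆ {y | x ∈ ball y α'} ∧ {y | x ∈ ball y β} ⊆ ball x β'
  comp_ball : ∀ α β : P, ∃ γ : P, ∀ x : X, (⋃ a ∈ ball x α, ball a β) ⊆ ball x γ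
  conn_ball : ∀ x y : X, ∃ α : P, y ∈ ball x α

namespace Ballean

variable {X : Type u} {P : Type v} (B : Ballean X P)

/-- `B(A, α)`, the union of the balls of radius `α` around the points of `A`. -/
def ballSet (A : Set X) (α : P) : Set X := ⋃ a ∈ A, B.ball a α

/-- Bounded subsets. -/
def IsBounded (V : Set X) : Prop := ∃ (x : X) (α : P), V ⊆ B.ball x α

/-- Large subsets. -/
def IsLarge (A : Set X) : Prop := ∃ α : P, B.ballSet A α = Set.univ

/-- Small subsets. -/
def IsSmall (A : Set X) : Prop := ∀ α : P, B.IsLarge (Set.univ \ B.ballSet A α)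

/-- Thick subsets. -/
def IsThick (A : Set X) : Prop := ∀ α : P, ∃ a ∈ A, B.ball a α ⊆ A

/-- Thin subsets. -/
def IsThin (A : Set X) : Prop :=
  ∀ α : P, ∃ V : Set X, B.IsBounded V ∧
    ∀ a ∈ A \ V, ∀ a' ∈ A \ V, a ≠ a' → B.ball a α ∩ B.ball a' α = ∅

/-- The density: the least cardinality of a large subset. -/
noncomputable def den : Cardinal.{u} :=
  sInf {c | ∃ L : Set X, B.IsLarge L ∧ c = #L}

/-- The resolvability: the supremum of the cardinalities of the disjoint families of
large subsets. -/
noncomputable def res : Cardinal.{u} :=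
  sSup {c | ∃ F : Set (Set X), F.PairwiseDisjoint id ∧ (∀ A ∈ F, B.IsLarge A) ∧ c = #F}

/-- The coresolvability: the least cardinality of a covering by small subsets. -/
noncomputable def cores : Cardinal.{u} :=
  sInf {c | ∃ F : Set (Set X), ⋃₀ F = Set.univ ∧ (∀ A ∈ F, B.IsSmall A) ∧ c = #F}

/-- The supremum of the cardinalities of the disjoint families of thick subsets. -/
noncomputable def thick : Cardinal.{u} :=
  sSup {c | ∃ F : Set (Set X), F.PairwiseDisjoint id ∧ (∀ A ∈ F, B.IsThick A) ∧ c = #F}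

/-- The least cardinality of a covering by thin subsets. -/
noncomputable def thin : Cardinal.{u} :=
  sInf {c | ∃ F : Set (Set X), ⋃₀ F = Set.univ ∧ (∀ A ∈ F, B.IsThin A) ∧ c = #F}

/-- The cardinality of `Y` modulo bounded sets: the least cardinality of `Y \ V` with `V`
bounded. -/
noncomputable def cardMod (Y : Set X) : Cardinal.{u} :=
  sInf {c | ∃ V : Set X, B.IsBounded V ∧ c = #(Y \ V : Set X)}

/-- The spread: the supremum of the cardinalities modulo bounded sets of the thin subsets. -/
noncomputable def spread : Cardinal.{u} :=
  sSup {c | ∃ Y : Set X, B.IsThin Y ∧ c = B.cardMod Y}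

end Ballean

/-- The interval `[x, x + α]` in the set `κ` of the ordinals below (the initial ordinal of) `κ`. -/
def rightBall (κ : Cardinal.{u}) (x α : Set.Iio κ.ord) : Set (Set.Iio κ.ord) :=
  {y | x.1 ≤ y.1 ∧ y.1 ≤ x.1 + α.1}

/-- The set of all `y` in `κ` with `x ∈ [y, y + α]`. -/
def leftBall (κ : Cardinal.{u}) (x α : Set.Iio κ.ord) : Set (Set.Iio κ.ord) :=
  {y | x ∈ rightBall κ y α}

theorem mem_union_ball_iff {κ : Cardinal.{u}} {x y α : Set.Iio κ.ord} :
    y ∈ rightBall κ x α ∪ leftBall κ x α ↔ y.1 ≤ x.1 + α.1 ∧ x.1 ≤ y.1 + α.1 := by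
  simp only [rightBall, leftBall, Set.mem_union, Set.mem_ofPred_eq]
  constructor
  · rintro (⟨h, h'⟩ | ⟨h, h'⟩)
    · exact ⟨h', h.trans le_self_add⟩
    · exact ⟨h.trans le_self_add, h'⟩
  · rintro ⟨h, h'⟩
    rcases le_total x.1 y.1 with h2 | h2
    · exact Or.inl ⟨h2, h⟩
    · exact Or.inr ⟨h2, h'⟩

/-- The cardinal ballean on an infinite cardinal `κ`: both the support and the set of radii are
the set of the ordinals below `κ`. -/
def cardinalBallean (κ : Cardinal.{u}) (hκ : ℵ₀ ≤ κ) : Ballean (Set.Iio κ.ord) (Set.Iio κ.ord) where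
  ball x α := rightBall κ x α ∪ leftBall κ x α
  nonempty_support := ⟨⟨0, (isSuccLimit_ord hκ).bot_lt⟩⟩
  nonempty_radii := ⟨⟨0, (isSuccLimit_ord hκ).bot_lt⟩⟩
  mem_ball x α := Or.inl ⟨le_rfl, le_self_add⟩
  symm_ball α β := by
    refine ⟨α, β, fun x => ⟨fun y hy => ?_, fun y hy => ?_⟩⟩
    · exact mem_union_ball_iff.2 (mem_union_ball_iff.1 hy).symm
    · exact mem_union_ball_iff.2 (mem_union_ball_iff.1 hy).symm
  comp_ball α β := by
    have hp := Ordinal.isPrincipal_add_ord hκ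
    have h1 : α.1 + β.1 < κ.ord := hp α.2 β.2
    have h2 : β.1 + α.1 < κ.ord := hp β.2 α.2
    refine ⟨⟨max (α.1 + β.1) (β.1 + α.1), max_lt h1 h2⟩, fun x y hy => ?_⟩
    simp only [Set.mem_iUnion] at hy
    obtain ⟨a, ha, hy⟩ := hy
    rw [mem_union_ball_iff] at ha hy ⊢
    constructor
    · calc y.1 ≤ a.1 + β.1 := hy.1
        _ ≤ x.1 + α.1 + β.1 := by gcongr; exact ha.1
        _ = x.1 + (α.1 + β.1) := add_assoc _ _ _
        _ ≤ _ := by gcongr; exact le_max_left _ _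
    · calc x.1 ≤ a.1 + α.1 := ha.2
        _ ≤ y.1 + β.1 + α.1 := by gcongr; exact hy.2
        _ = y.1 + (β.1 + α.1) := add_assoc _ _ _
        _ ≤ _ := by gcongr; exact le_max_right _ _
  conn_ball x y := by
    refine ⟨max x y, ?_⟩
    rw [mem_union_ball_iff]
    have hx : x.1 ≤ (max x y : Set.Iio κ.ord).1 := le_max_left x y
    have hy : y.1 ≤ (max x y : Set.Iio κ.ord).1 := le_max_right x y
    exact ⟨hy.trans le_add_self, hx.trans le_add_self⟩

/-!
Every invariant is computed from a handful of explicit sets, described through the expansions of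
ordinals in the bases `2`, `4` and `ω`. These descriptions are uniform in `κ`: an
infinite cardinal is closed under addition, multiplication and exponentiation of ordinals, so that `ℵ₀` and
singular `κ` need no separate treatment.

* A ball of radius `α` has at most `|α + α + 1| < κ` points (`mk_ball_le`), so a large set, over
  which balls of a fixed radius cover `κ`, has `κ` points.
* The points `4 ^ μ * 2` form a thin set of cardinality `κ`: a ball of radius `α < 4 ^ μ` around
  `4 ^ μ * 2` stays inside `[4 ^ μ, 4 ^ (μ + 1))` (`Ordinal.log_four_eq_of_close`). As bounded sets
  have fewer than `κ` points, this thin set still has `κ` points modulo bounded sets.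
* The ordinals `2 ^ (ξ + 1) * β + 2 ^ ξ`, with `ξ` fixed, form a large set, and distinct `ξ` give
  disjoint sets. Taking the ordinals whose logarithm in base `4` lies in such a set yields disjoint
  thick sets. Both families extend to partitions (`Ballean.exists_isPartition`).
* Small sets form an ideal not containing `κ`, so a covering by small sets is infinite. The ordinals
  whose coefficients in the Cantor normal form are at most `n` form a small set
  (`isSmall_boundedCoeff`), and since every ordinal has finitely many coefficients, these sets cover
  `κ` as `n` varies.
* Bounded sets are thin, so `cf κ` thin sets suffice. Fewer than `cf κ` thin sets are simultaneously
  `α`-separated beyond some `x`, and then meet `[x, x + α)` in at most one point each, which forces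
  at least `|α|` of them (`card_le_of_isThin_covering`). If `κ` is a limit cardinal, some `α < κ` has
  larger cardinality than the covering, so `cf κ` is optimal. In `κ⁺` one takes `α = κ` for the
  lower bound; conversely, a set with at most one point in each interval `[ω ^ μ, ω ^ (μ + 1))` is
  thin, and as these intervals have at most `κ` points, `κ` such sets cover `κ⁺`.
-/

/-! ### Balleans -/

namespace Ballean

variable {X : Type u} {P : Type v} {B : Ballean X P}

theorem isLarge_iff {A : Set X} : B.IsLarge A ↔ ∃ α, ∀ x, ∃ a ∈ A, x ∈ B.ball a α := by
  simp [IsLarge, ballSet, Set.eq_univ_iff_forall]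

theorem IsLarge.mono {A A' : Set X} (hA : B.IsLarge A) (h : A ⊆ A') : B.IsLarge A' := by
  rw [isLarge_iff] at hA ⊢
  obtain ⟨α, hα⟩ := hA
  exact ⟨α, fun x => (hα x).imp fun a ha => ⟨h ha.1, ha.2⟩⟩

theorem IsLarge.nonempty {A : Set X} (hA : B.IsLarge A) : A.Nonempty := by
  obtain ⟨α, hα⟩ := isLarge_iff.1 hA
  obtain ⟨x⟩ := B.nonempty_support
  obtain ⟨a, ha, -⟩ := hα x
  exact ⟨a, ha⟩

theorem isLarge_univ : B.IsLarge Set.univ := by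
  obtain ⟨α⟩ := B.nonempty_radii
  exact isLarge_iff.2 ⟨α, fun x => ⟨x, trivial, B.mem_ball x α⟩⟩

theorem IsThick.mono {A A' : Set X} (hA : B.IsThick A) (h : A ⊆ A') : B.IsThick A' := fun α =>
  (hA α).imp fun _ ha => ⟨h ha.1, ha.2.trans h⟩

theorem IsThick.nonempty {A : Set X} (hA : B.IsThick A) : A.Nonempty := by
  obtain ⟨α⟩ := B.nonempty_radii
  obtain ⟨a, ha, -⟩ := hA α
  exact ⟨a, ha⟩

theorem IsBounded.isThin {A : Set X} (hA : B.IsBounded A) : B.IsThin A := fun _ =>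
  ⟨A, hA, fun _ ha => absurd ha.1 ha.2⟩

theorem thin_le_mk {F : Set (Set X)} (hF : ⋃₀ F = Set.univ) (h : ∀ A ∈ F, B.IsThin A) :
    B.thin ≤ #F :=
  csInf_le' ⟨F, hF, h, rfl⟩

theorem le_thin {c : Cardinal.{u}}
    (hc : ∀ F : Set (Set X), ⋃₀ F = Set.univ → (∀ A ∈ F, B.IsThin A) → c ≤ #F) :
    c ≤ B.thin := by
  -- the infimum is over a nonempty set, as singletons are thin
  refine le_csInf ⟨_, Set.range singleton, ?_, ?_, rfl⟩ ?_
  · exact Set.eq_univ_of_forall fun x => ⟨{x}, ⟨x, rfl⟩, rfl⟩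
  · rintro _ ⟨x, rfl⟩
    obtain ⟨α⟩ := B.nonempty_radii
    exact IsBounded.isThin ⟨x, α, Set.singleton_subset_iff.2 (B.mem_ball x α)⟩
  · rintro _ ⟨F, hF, h, rfl⟩
    exact hc F hF h

/-- A point near a point `y` that is far from `A` is near the points of `L` around `y`, and those
lie outside `A`. -/
theorem IsLarge.diff_isSmall {L A : Set X} (hL : B.IsLarge L) (hA : B.IsSmall A) :
    B.IsLarge (L \ A) := by
  obtain ⟨α, hα⟩ := isLarge_iff.1 hL
  obtain ⟨δ, hδ⟩ := isLarge_iff.1 (hA α)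
  obtain ⟨γ, hγ⟩ := B.comp_ball α δ
  refine isLarge_iff.2 ⟨γ, fun x => ?_⟩
  obtain ⟨y, hy, hxy⟩ := hδ x
  obtain ⟨l, hl, hyl⟩ := hα y
  exact ⟨l, ⟨hl, fun hlA => hy.2 (Set.mem_biUnion hlA hyl)⟩, hγ l (Set.mem_biUnion hyl hxy)⟩

theorem isLarge_compl_sUnion {F : Set (Set X)} (hF : F.Finite) (h : ∀ A ∈ F, B.IsSmall A) :
    B.IsLarge (⋃₀ F)ᶜ := by
  induction F, hF using Set.Finite.induction_on with
  | empty => simpa using isLarge_univ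
  | @insert A F _ _ ih =>
    have := (ih fun A' hA' => h A' (Set.mem_insert_of_mem _ hA')).diff_isSmall
      (h A (Set.mem_insert _ _))
    rwa [Set.sUnion_insert, Set.compl_union, Set.inter_comm]

/-- Finitely many small sets do not cover the support. -/
theorem infinite_of_sUnion_eq_univ {F : Set (Set X)} (hF : ⋃₀ F = Set.univ)
    (h : ∀ A ∈ F, B.IsSmall A) : F.Infinite := by
  intro hfin
  simpa [hF] using (isLarge_compl_sUnion hfin h).nonempty

/-- A disjoint family of sets with a property that passes to supersets extends to a partition into
sets with this property: one member of the family absorbs the points that are not covered. -/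
theorem exists_isPartition {ι : Type u} [Nonempty ι] {p : Set X → Prop}
    (hmono : ∀ A A', p A → A ⊆ A' → p A') (hne : ∀ A, p A → A.Nonempty) {L : ι → Set X}
    (hL : ∀ i, p (L i)) (hdisj : ∀ i j x, x ∈ L i → x ∈ L j → i = j) :
    ∃ F : Set (Set X), Setoid.IsPartition F ∧ #F = #ι ∧ ∀ A ∈ F, p A := by
  classical
  let f : X → ι := fun x => if h : ∃ i, x ∈ L i then h.choose else Classical.arbitrary ι
  have hf : ∀ i x, x ∈ L i → f x = i := fun i x hx => by
    have h : ∃ i, x ∈ L i := ⟨i, hx⟩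
    simp only [f, dif_pos h]
    exact hdisj _ _ x h.choose_spec hx
  have hp : ∀ i, p (f ⁻¹' {i}) := fun i => hmono _ _ (hL i) fun x hx => hf i x hx
  have hinj : Function.Injective fun i => f ⁻¹' {i} := fun i j hij => by
    obtain ⟨x, hx⟩ := hne _ (hp i)
    have hx' : x ∈ f ⁻¹' {j} := by
      rw [← show f ⁻¹' {i} = f ⁻¹' {j} from hij]
      exact hx
    exact hx.symm.trans hx'
  refine ⟨Set.range fun i => f ⁻¹' {i}, ⟨?_, fun x => ⟨f ⁻¹' {f x}, ⟨⟨f x, rfl⟩, rfl⟩, ?_⟩⟩,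
    mk_range_eq _ hinj, ?_⟩
  · rintro ⟨i, hi⟩
    exact (hne _ (hp i)).ne_empty hi
  · rintro _ ⟨⟨i, rfl⟩, hx⟩
    have hx : f x = i := hx
    rw [hx]
  · rintro _ ⟨i, rfl⟩
    exact hp i

theorem mk_le_of_pairwiseDisjoint {F : Set (Set X)} (hF : F.PairwiseDisjoint id)
    (hne : ∀ A ∈ F, A.Nonempty) : #F ≤ #X := by
  choose f hf using hne
  refine mk_le_of_injective (f := fun A : F => f A.1 A.2) fun A A' h => Subtype.ext ?_
  refine hF.elim A.2 A'.2 (Set.not_disjoint_iff.2 ⟨f A.1 A.2, hf _ _, ?_⟩)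
  have h : f A.1 A.2 = f A'.1 A'.2 := h
  rw [h]
  exact hf _ _

/-- The supremum of the cardinalities of the disjoint families of nonempty sets with a property
is `#X` as soon as some partition into such sets has `#X` members. -/
theorem sSup_disjoint_eq {p : Set X → Prop} (hne : ∀ A, p A → A.Nonempty)
    (h : ∃ F : Set (Set X), Setoid.IsPartition F ∧ #F = #X ∧ ∀ A ∈ F, p A) :
    sSup {c | ∃ F : Set (Set X), F.PairwiseDisjoint id ∧ (∀ A ∈ F, p A) ∧ c = #F} = #X := by
  have hub : ∀ c ∈ {c | ∃ F : Set (Set X), F.PairwiseDisjoint id ∧ (∀ A ∈ F, p A) ∧ c = #F},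
      c ≤ #X := by
    rintro _ ⟨F, hF, hp, rfl⟩
    exact mk_le_of_pairwiseDisjoint hF fun A hA => hne A (hp A hA)
  refine le_antisymm (csSup_le' hub) ?_
  obtain ⟨F, hF, hcard, hp⟩ := h
  exact le_csSup ⟨_, hub⟩ ⟨F, hF.pairwiseDisjoint, hp, hcard.symm⟩

end Ballean

/-! ### Ordinal arithmetic -/

namespace Ordinal

/-- The least exponent in base `2` is well defined. -/
theorem two_opow_mul_add_inj {ξ η β β' : Ordinal.{u}}
    (h : 2 ^ (ξ + 1) * β + 2 ^ ξ = (2 : Ordinal.{u}) ^ (η + 1) * β' + 2 ^ η) : ξ = η := by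
  have key : ∀ {ξ η β β' : Ordinal.{u}}, ξ < η →
      2 ^ (ξ + 1) * β + 2 ^ ξ ≠ (2 : Ordinal.{u}) ^ (η + 1) * β' + 2 ^ η := by
    intro ξ η β β' hlt h
    -- modulo `2 ^ (ξ + 1)` the left side is `2 ^ ξ` and the right side is `0`
    have h1 : (2 ^ (ξ + 1) * β + 2 ^ ξ) % (2 : Ordinal.{u}) ^ (ξ + 1) = 2 ^ ξ := by
      rw [mul_add_mod_self, mod_eq_of_lt]
      exact (opow_lt_opow_iff_right one_lt_two).2 (lt_add_one ξ)
    have hle : ξ + 1 ≤ η := Order.add_one_le_of_lt hlt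
    have h2 : (2 ^ (η + 1) * β' + 2 ^ η) % (2 : Ordinal.{u}) ^ (ξ + 1) = 0 := by
      refine mod_eq_zero_of_dvd ((dvd_add_iff (Dvd.dvd.mul_right ?_ β')).2 ?_)
      · exact opow_dvd_opow 2 (hle.trans le_self_add)
      · exact opow_dvd_opow 2 hle
    rw [h, h2] at h1
    exact opow_ne_zero ξ two_ne_zero h1.symm
  rcases lt_trichotomy ξ η with hlt | heq | hlt
  · exact absurd h (key hlt)
  · exact heq
  · exact absurd h.symm (key hlt)

theorem four_opow_add_one (μ : Ordinal.{u}) :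
    (4 : Ordinal.{u}) ^ (μ + 1) = 4 ^ μ * 2 + 4 ^ μ * 2 := by
  rw [opow_add_one, ← mul_add]
  congr 1
  exact_mod_cast (by norm_num : (4 : ℕ) = 2 + 2)

/-- Every ball of radius `α < 4 ^ μ` around `4 ^ μ * 2` lies in `[4 ^ μ, 4 ^ (μ + 1))`. -/
theorem log_four_eq_of_close {μ α z : Ordinal.{u}} (hα : α < 4 ^ μ) (h1 : z ≤ 4 ^ μ * 2 + α)
    (h2 : 4 ^ μ * 2 ≤ z + α) : log 4 z = μ := by
  have hlow : 4 ^ μ ≤ z := by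
    by_contra! hz
    rw [Ordinal.mul_two] at h2
    have : z + α < 4 ^ μ + 4 ^ μ :=
      (add_le_add_left hz.le α).trans_lt (add_lt_add_right hα (4 ^ μ))
    exact this.not_ge h2
  have hup : z < 4 ^ (μ + 1) := by
    rw [four_opow_add_one]
    refine h1.trans_lt (add_lt_add_right (hα.trans_le ?_) _)
    exact le_mul_left _ two_pos
  have hz : z ≠ 0 := ((opow_pos μ (zero_lt_one.trans Nat.one_lt_ofNat)).trans_le hlow).ne'
  refine (log_eq_iff Nat.one_lt_ofNat hz μ).2 ⟨hlow, hup⟩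

/-- The coefficients of the Cantor normal form of an ordinal are bounded by a natural number. -/
theorem exists_forall_div_opow_mod_omega0_le (z : Ordinal.{u}) :
    ∃ n : ℕ, ∀ e : Ordinal.{u}, z / ω ^ e % ω ≤ n := by
  induction z using CNF.rec ω with
  | H0 => exact ⟨0, fun e => by simp⟩
  | H z hz ih =>
    obtain ⟨n, hn⟩ := ih
    obtain ⟨c, hc⟩ := lt_omega0.1 (div_opow_log_lt z one_lt_omega0)
    have hz' : ω ^ log ω z * (c : Ordinal) + z % ω ^ log ω z = z := by rw [← hc, div_add_mod]
    refine ⟨max n c, fun e => ?_⟩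
    rcases lt_trichotomy e (log ω z) with he | rfl | he
    · refine le_trans ?_ ((hn e).trans (by exact_mod_cast le_max_left n c))
      obtain ⟨d, hd⟩ := exists_add_of_le (Order.add_one_le_of_lt he)
      -- the leading term contributes a multiple of `ω` to the quotient by `ω ^ e`
      have : z / ω ^ e = ω * (ω ^ d * c) + z % ω ^ log ω z / ω ^ e := by
        conv_lhs => rw [← hz', hd, opow_add, opow_add, opow_one, mul_assoc, mul_assoc,
          mul_add_div _ (opow_ne_zero e omega0_ne_zero)]
        rw [hd, opow_add, opow_add, opow_one]
      rw [this, mul_add_mod_self]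
    · rw [hc, natCast_mod_omega0]
      exact_mod_cast le_max_right n c
    · rw [div_eq_zero_of_lt (lt_opow_of_log_lt one_lt_omega0 he), zero_mod]
      exact zero_le

end Ordinal

/-! ### Balls of the cardinal ballean -/

namespace CardinalBallean

open Ordinal Set

variable {κ : Cardinal.{u}}

theorem mem_ball (hκ : ℵ₀ ≤ κ) {x α y : Iio κ.ord} :
    y ∈ (cardinalBallean κ hκ).ball x α ↔ y.1 ≤ x.1 + α.1 ∧ x.1 ≤ y.1 + α.1 :=
  mem_union_ball_iff

theorem mk_Iio_ord : #(Iio κ.ord) = lift.{u + 1} κ := by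
  rw [Cardinal.mk_Iio_ordinal, card_ord]

theorem add_lt_ord (hκ : ℵ₀ ≤ κ) {a b : Ordinal.{u}} (ha : a < κ.ord) (hb : b < κ.ord) :
    a + b < κ.ord :=
  isPrincipal_add_ord hκ ha hb

theorem nat_lt_ord (hκ : ℵ₀ ≤ κ) (n : ℕ) : (n : Ordinal.{u}) < κ.ord :=
  natCast_lt_of_isSuccLimit (isSuccLimit_ord hκ) n

theorem add_one_lt_ord (hκ : ℵ₀ ≤ κ) {a : Ordinal.{u}} (ha : a < κ.ord) : a + 1 < κ.ord :=
  (isSuccLimit_ord hκ).add_one_lt ha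

theorem mul_lt_ord (hκ : ℵ₀ ≤ κ) {a b : Ordinal.{u}} (ha : a < κ.ord) (hb : b < κ.ord) :
    a * b < κ.ord :=
  isPrincipal_mul_ord hκ ha hb

theorem opow_lt_ord (hκ : ℵ₀ ≤ κ) {a b : Ordinal.{u}} (ha : a < κ.ord) (hb : b < κ.ord) :
    a ^ b < κ.ord :=
  isPrincipal_opow_ord hκ ha hb

theorem isBounded_iff (hκ : ℵ₀ ≤ κ) {V : Set (Iio κ.ord)} :
    (cardinalBallean κ hκ).IsBounded V ↔ BddAbove V := by
  constructor
  · rintro ⟨x, α, h⟩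
    exact ⟨⟨x.1 + α.1, add_lt_ord hκ x.2 α.2⟩, fun y hy => ((mem_ball hκ).1 (h hy)).1⟩
  · rintro ⟨b, hb⟩
    refine ⟨⟨0, (isSuccLimit_ord hκ).bot_lt⟩, b, fun y hy => (mem_ball hκ).2 ⟨?_, zero_le⟩⟩
    simpa using hb hy

theorem isBounded_empty (hκ : ℵ₀ ≤ κ) : (cardinalBallean κ hκ).IsBounded ∅ :=
  ⟨⟨0, (isSuccLimit_ord hκ).bot_lt⟩, ⟨0, (isSuccLimit_ord hκ).bot_lt⟩, empty_subset _⟩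

theorem mk_Iic_lt_lift (hκ : ℵ₀ ≤ κ) (b : Iio κ.ord) : #(Iic b) < lift.{u + 1} κ := by
  have h : #(Iic b) ≤ #(Iio (b.1 + 1)) :=
    mk_le_of_injective (f := fun y : Iic b =>
      (⟨y.1.1, mem_Iio.2 (Order.lt_add_one_iff.2 y.2)⟩ : Iio (b.1 + 1))) fun y y' h =>
        Subtype.ext (Subtype.ext (congrArg Subtype.val h :))
  refine h.trans_lt ?_
  rw [Cardinal.mk_Iio_ordinal, Cardinal.lift_lt]
  exact lt_ord.1 (add_one_lt_ord hκ b.2)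

/-- With `m` the least centre whose ball of radius `α` reaches `x`, the ball of radius `α` around
`x` lies in `[m, m + α + α]`. -/
theorem mk_ball_le (hκ : ℵ₀ ≤ κ) (x α : Iio κ.ord) :
    #((cardinalBallean κ hκ).ball x α) ≤ lift.{u + 1} (α.1 + α.1 + 1).card := by
  set m : Ordinal := sInf {y | x.1 ≤ y + α.1} with hm
  have hxm : x.1 ≤ m + α.1 :=
    csInf_mem (s := {y | x.1 ≤ y + α.1}) ⟨x.1, mem_ofPred.2 le_self_add⟩
  have hmy : ∀ y ∈ (cardinalBallean κ hκ).ball x α, m ≤ y.1 := fun y hy =>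
    csInf_le' (((mem_ball hκ).1 hy).2 : y.1 ∈ {y | x.1 ≤ y + α.1})
  rw [← Cardinal.mk_Iio_ordinal]
  refine mk_le_of_injective (f := fun y : (cardinalBallean κ hκ).ball x α =>
    (⟨y.1.1 - m, ?_⟩ : Iio (α.1 + α.1 + 1))) fun y y' h => Subtype.ext (Subtype.ext ?_)
  · refine Order.lt_add_one_iff.2 (Ordinal.sub_le.2 ?_)
    rw [← add_assoc]
    exact ((mem_ball hκ).1 y.2).1.trans (by gcongr)
  · have h : y.1.1 - m = y'.1.1 - m := congrArg Subtype.val h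
    rw [← Ordinal.add_sub_cancel_of_le (hmy _ y.2), h, Ordinal.add_sub_cancel_of_le (hmy _ y'.2)]

/-! ### Density and spread -/

theorem mk_eq_of_isLarge (hκ : ℵ₀ ≤ κ) {L : Set (Iio κ.ord)}
    (hL : (cardinalBallean κ hκ).IsLarge L) :
    #L = lift.{u + 1} κ := by
  refine le_antisymm ((mk_set_le L).trans mk_Iio_ord.le) ?_
  by_contra! hlt
  obtain ⟨α, hα⟩ := hL
  have hc : lift.{u + 1} (α.1 + α.1 + 1).card < lift.{u + 1} κ :=
    Cardinal.lift_lt.2 (lt_ord.1 (add_one_lt_ord hκ (add_lt_ord hκ α.2 α.2)))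
  have h1 : lift.{u + 1} κ ≤ #L * lift.{u + 1} (α.1 + α.1 + 1).card := by
    rw [← mk_Iio_ord, ← mk_univ, ← hα]
    exact (mk_biUnion_le _ _).trans (by gcongr; exact ciSup_le' fun x => mk_ball_le hκ _ _)
  exact h1.not_gt (mul_lt_of_lt (aleph0_le_lift.2 hκ) hlt hc)

theorem den_eq (hκ : ℵ₀ ≤ κ) : (cardinalBallean κ hκ).den = lift.{u + 1} κ := by
  refine le_antisymm (csInf_le' ⟨univ, Ballean.isLarge_univ, ?_⟩) (le_csInf ⟨_, univ,
    Ballean.isLarge_univ, rfl⟩ ?_)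
  · rw [mk_univ, mk_Iio_ord]
  · rintro _ ⟨L, hL, rfl⟩
    exact (mk_eq_of_isLarge hκ hL).ge

/-- The middle `4 ^ μ * 2` of the interval `[4 ^ μ, 4 ^ (μ + 1))`. -/
noncomputable def center (hκ : ℵ₀ ≤ κ) (μ : Iio κ.ord) : Iio κ.ord :=
  ⟨4 ^ μ.1 * 2, mul_lt_ord hκ (opow_lt_ord hκ (nat_lt_ord hκ 4) μ.2) (nat_lt_ord hκ 2)⟩

theorem center_injective (hκ : ℵ₀ ≤ κ) : Function.Injective (center hκ) := fun μ ν h => by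
  have h : (4 : Ordinal) ^ μ.1 * 2 = 4 ^ ν.1 * 2 := congrArg Subtype.val h
  have h' := congrArg (log 4) h
  have hpos : ∀ ξ : Ordinal.{u}, (0 : Ordinal) < 4 ^ ξ := fun ξ =>
    opow_pos ξ (zero_lt_one.trans Nat.one_lt_ofNat)
  rw [log_four_eq_of_close (μ := μ.1) (hpos _) le_self_add le_self_add,
    log_four_eq_of_close (μ := ν.1) (hpos _) le_self_add le_self_add] at h'
  exact Subtype.ext h'

theorem log_four_eq_of_mem_ball_center (hκ : ℵ₀ ≤ κ) {μ α y : Iio κ.ord} (hα : α.1 < 4 ^ μ.1)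
    (hy : y ∈ (cardinalBallean κ hκ).ball (center hκ μ) α) : log 4 y.1 = μ.1 :=
  log_four_eq_of_close hα ((mem_ball hκ).1 hy).1 ((mem_ball hκ).1 hy).2

/-- Balls of radius `α` around the points `4 ^ μ * 2` beyond `α + α` lie in disjoint intervals. -/
theorem isThin_range_center (hκ : ℵ₀ ≤ κ) :
    (cardinalBallean κ hκ).IsThin (range (center hκ)) := by
  intro α
  refine ⟨Iic ⟨α.1 + α.1, add_lt_ord hκ α.2 α.2⟩, (isBounded_iff hκ).2 bddAbove_Iic, ?_⟩
  have hfar : ∀ μ : Iio κ.ord, center hκ μ ∉ Iic ⟨α.1 + α.1, add_lt_ord hκ α.2 α.2⟩ →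
      α.1 < 4 ^ μ.1 := fun μ hμ => by
    by_contra! h
    refine hμ (?_ : (4 : Ordinal) ^ μ.1 * 2 ≤ α.1 + α.1)
    rw [Ordinal.mul_two]
    gcongr
  rintro _ ⟨⟨μ, rfl⟩, hμ⟩ _ ⟨⟨ν, rfl⟩, hν⟩ hne
  refine eq_empty_of_forall_notMem fun y hy => hne ?_
  rw [Subtype.ext ((log_four_eq_of_mem_ball_center hκ (hfar μ hμ) hy.1).symm.trans
    (log_four_eq_of_mem_ball_center hκ (hfar ν hν) hy.2))]

/-- Bounded sets have fewer than `κ` points, so removing one from a set of full cardinality does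
not lower its cardinality. -/
theorem cardMod_eq_of_mk_eq (hκ : ℵ₀ ≤ κ) {Y : Set (Iio κ.ord)} (hY : #Y = lift.{u + 1} κ) :
    (cardinalBallean κ hκ).cardMod Y = lift.{u + 1} κ := by
  refine le_antisymm (csInf_le' ⟨∅, isBounded_empty hκ, by rw [sdiff_empty, hY]⟩)
    (le_csInf ⟨_, ∅, isBounded_empty hκ, rfl⟩ ?_)
  rintro _ ⟨V, hV, rfl⟩
  obtain ⟨b, hb⟩ := (isBounded_iff hκ).1 hV
  by_contra! hlt
  have h1 : #Y ≤ #(Y \ V : Set _) + #(Iic b) := by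
    refine (mk_le_mk_of_subset fun y hy => ?_).trans (mk_union_le (Y \ V) (Iic b))
    by_cases hyV : y ∈ V
    · exact Or.inr (hb hyV)
    · exact Or.inl ⟨hy, hyV⟩
  rw [hY] at h1
  exact h1.not_gt (add_lt_of_lt (aleph0_le_lift.2 hκ) hlt (mk_Iic_lt_lift hκ b))

theorem cardMod_le_mk (hκ : ℵ₀ ≤ κ) (Y : Set (Iio κ.ord)) : (cardinalBallean κ hκ).cardMod Y ≤ #Y :=
  csInf_le' ⟨∅, isBounded_empty hκ, by rw [sdiff_empty]⟩

theorem spread_eq (hκ : ℵ₀ ≤ κ) : (cardinalBallean κ hκ).spread = lift.{u + 1} κ := by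
  have hub : ∀ c ∈ {c | ∃ Y, (cardinalBallean κ hκ).IsThin Y ∧
      c = (cardinalBallean κ hκ).cardMod Y}, c ≤ lift.{u + 1} κ := by
    rintro _ ⟨Y, -, rfl⟩
    exact (cardMod_le_mk hκ Y).trans ((mk_set_le Y).trans mk_Iio_ord.le)
  refine le_antisymm (csSup_le' hub) (le_csSup ⟨_, hub⟩ ⟨_, isThin_range_center hκ, ?_⟩)
  rw [cardMod_eq_of_mk_eq]
  rw [mk_range_eq _ (center_injective hκ), mk_Iio_ord]

/-! ### Large and thick partitions -/

/-- The ordinals below `κ` whose least exponent in base `2` is `ξ`. -/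
def leastExponent (ξ : Iio κ.ord) : Set (Iio κ.ord) :=
  {x | ∃ β : Ordinal, x.1 = 2 ^ (ξ.1 + 1) * β + 2 ^ ξ.1}

theorem eq_of_mem_leastExponent {ξ η x : Iio κ.ord} (hξ : x ∈ leastExponent ξ)
    (hη : x ∈ leastExponent η) : ξ = η := by
  obtain ⟨β, hβ⟩ := hξ
  obtain ⟨β', hβ'⟩ := hη
  exact Subtype.ext (two_opow_mul_add_inj (hβ.symm.trans hβ'))

/-- Every interval `[2 ^ (ξ + 1) * q, 2 ^ (ξ + 1) * (q + 1))` contains a point of the set. -/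
theorem isLarge_leastExponent (hκ : ℵ₀ ≤ κ) (ξ : Iio κ.ord) :
    (cardinalBallean κ hκ).IsLarge (leastExponent ξ) := by
  have hp : (2 : Ordinal) ^ (ξ.1 + 1) < κ.ord :=
    opow_lt_ord hκ (nat_lt_ord hκ 2) (add_one_lt_ord hκ ξ.2)
  have hle : (2 : Ordinal) ^ ξ.1 ≤ 2 ^ (ξ.1 + 1) := opow_le_opow_right two_pos le_self_add
  refine Ballean.isLarge_iff.2 ⟨⟨2 ^ (ξ.1 + 1), hp⟩, fun x => ?_⟩
  set q := x.1 / 2 ^ (ξ.1 + 1) with hq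
  have hqx : 2 ^ (ξ.1 + 1) * q ≤ x.1 := mul_div_le _ _
  have hxq : x.1 < 2 ^ (ξ.1 + 1) * q + 2 ^ (ξ.1 + 1) :=
    lt_mul_div_add _ (opow_ne_zero _ two_ne_zero)
  refine ⟨⟨2 ^ (ξ.1 + 1) * q + 2 ^ ξ.1, ?_⟩, ⟨q, rfl⟩, (mem_ball hκ).2 ⟨?_, ?_⟩⟩
  · exact add_lt_ord hκ (hqx.trans_lt x.2) (hle.trans_lt hp)
  · exact hxq.le.trans (by gcongr; exact le_self_add)
  · exact add_le_add hqx hle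

/-- The ordinals whose base `4` logarithm lies in `leastExponent ξ`: a union of the intervals
`[4 ^ μ, 4 ^ (μ + 1))` over an unbounded set of exponents `μ`. -/
def logLeastExponent (ξ : Iio κ.ord) : Set (Iio κ.ord) :=
  {x | ∃ μ ∈ leastExponent ξ, log 4 x.1 = μ.1}

theorem eq_of_mem_logLeastExponent {ξ η x : Iio κ.ord} (hξ : x ∈ logLeastExponent ξ)
    (hη : x ∈ logLeastExponent η) : ξ = η := by
  obtain ⟨μ, hμ, h⟩ := hξ
  obtain ⟨ν, hν, h'⟩ := hη
  obtain rfl : μ = ν := Subtype.ext (h.symm.trans h')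
  exact eq_of_mem_leastExponent hμ hν

theorem isThick_logLeastExponent (hκ : ℵ₀ ≤ κ) (ξ : Iio κ.ord) :
    (cardinalBallean κ hκ).IsThick (logLeastExponent ξ) := by
  intro α
  have hp : ∀ η : Iio κ.ord, (2 : Ordinal) ^ η.1 < κ.ord := fun η =>
    opow_lt_ord hκ (nat_lt_ord hκ 2) η.2
  -- an element of `leastExponent ξ` beyond `α`
  let μ : Iio κ.ord := ⟨2 ^ (ξ.1 + 1) * α.1 + 2 ^ ξ.1, add_lt_ord hκ
    (mul_lt_ord hκ (hp ⟨_, add_one_lt_ord hκ ξ.2⟩) α.2) (hp ξ)⟩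
  have hαμ : α.1 < μ.1 := (Ordinal.le_mul_right α.1 (opow_pos _ two_pos)).trans_lt
    (lt_add_of_pos_right _ (opow_pos _ two_pos))
  have hball : (cardinalBallean κ hκ).ball (center hκ μ) α ⊆ logLeastExponent ξ := fun y hy =>
    ⟨μ, ⟨α.1, rfl⟩, log_four_eq_of_mem_ball_center hκ
      (hαμ.trans_le (right_le_opow _ Nat.one_lt_ofNat)) hy⟩
  exact ⟨center hκ μ, hball ((cardinalBallean κ hκ).mem_ball _ _), hball⟩

theorem exists_isPartition_isLarge (hκ : ℵ₀ ≤ κ) :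
    ∃ F : Set (Set (Iio κ.ord)), Setoid.IsPartition F ∧ #F = #(Iio κ.ord) ∧ ∀ L ∈ F, (cardinalBallean κ hκ).IsLarge L :=
  have := (cardinalBallean κ hκ).nonempty_support
  Ballean.exists_isPartition (fun _ _ h => h.mono) (fun _ h => h.nonempty)
    (isLarge_leastExponent hκ) fun _ _ _ => eq_of_mem_leastExponent

theorem exists_isPartition_isThick (hκ : ℵ₀ ≤ κ) :
    ∃ F : Set (Set (Iio κ.ord)), Setoid.IsPartition F ∧ #F = #(Iio κ.ord) ∧ ∀ T ∈ F, (cardinalBallean κ hκ).IsThick T :=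
  have := (cardinalBallean κ hκ).nonempty_support
  Ballean.exists_isPartition (fun _ _ h => h.mono) (fun _ h => h.nonempty)
    (isThick_logLeastExponent hκ) fun _ _ _ => eq_of_mem_logLeastExponent

theorem res_eq (hκ : ℵ₀ ≤ κ) : (cardinalBallean κ hκ).res = #(Iio κ.ord) :=
  Ballean.sSup_disjoint_eq (fun _ h => h.nonempty) (exists_isPartition_isLarge hκ)

theorem thick_eq (hκ : ℵ₀ ≤ κ) : (cardinalBallean κ hκ).thick = #(Iio κ.ord) :=
  Ballean.sSup_disjoint_eq (fun _ h => h.nonempty) (exists_isPartition_isThick hκ)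

/-! ### Coverings by small sets -/

/-- The ordinals below `κ` all of whose coefficients in the Cantor normal form are at most `n`. -/
def boundedCoeff (κ : Cardinal.{u}) (n : ℕ) : Set (Iio κ.ord) :=
  {z | ∀ e : Ordinal, z.1 / ω ^ e % ω ≤ n}

/-- Let `α` lie below `ω ^ ζ * (c + 1)` and let `x` have quotient `m` by `ω ^ ζ`. In the ball of
radius `α` around `ω ^ ζ * (m + (c + n + 2))` all quotients by `ω ^ ζ` lie between `m + (n + 1)` and
`m + ω`, so that they have a finite part exceeding `n`. -/
theorem isSmall_boundedCoeff (hκ : ℵ₀ ≤ κ) (n : ℕ) :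
    (cardinalBallean κ hκ).IsSmall (boundedCoeff κ n) := by
  intro α
  set ζ := log ω α.1 with hζ
  have hζ0 : ω ^ ζ ≠ 0 := opow_ne_zero ζ omega0_ne_zero
  -- `log ω 0 = 0`, so that `ω ^ ζ = 1` exceeds `α` for `α = 0`
  have hζκ : ω ^ ζ < κ.ord := by
    rcases eq_or_ne α.1 0 with h0 | h0
    · simpa [hζ, h0] using nat_lt_ord hκ 1
    · exact (opow_log_le_self ω h0).trans_lt α.2
  obtain ⟨c, hc⟩ := lt_omega0.1 (div_opow_log_lt α.1 one_lt_omega0)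
  have hα : α.1 < ω ^ ζ * ((c + 1 : ℕ) : Ordinal) := by
    have := lt_mul_div_add α.1 hζ0
    rwa [hc, ← mul_add_one, ← Nat.cast_add_one] at this
  have hδ : ω ^ ζ * ((c + n + 2 : ℕ) : Ordinal) < κ.ord := mul_lt_ord hκ hζκ (nat_lt_ord hκ _)
  refine Ballean.isLarge_iff.2 ⟨⟨_, hδ⟩, fun x => ?_⟩
  set m := x.1 / ω ^ ζ with hm
  have hmx : ω ^ ζ * m ≤ x.1 := mul_div_le _ _
  have hp : ω ^ ζ * (m + ((c + n + 2 : ℕ) : Ordinal)) ≤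
      x.1 + ω ^ ζ * ((c + n + 2 : ℕ) : Ordinal) := by
    rw [mul_add]
    gcongr
  refine ⟨⟨_, hp.trans_lt (add_lt_ord hκ x.2 hδ)⟩, ⟨trivial, ?_⟩, (mem_ball hκ).2 ⟨?_, hp⟩⟩
  · intro hmem
    obtain ⟨z, hz, hzp⟩ := mem_iUnion₂.1 hmem
    obtain ⟨h1, h2⟩ := (mem_ball hκ).1 hzp
    have hlow : ω ^ ζ * (m + ((n + 1 : ℕ) : Ordinal)) ≤ z.1 := by
      by_contra! hlt
      refine h1.not_gt ?_
      calc z.1 + α.1 < ω ^ ζ * (m + ((n + 1 : ℕ) : Ordinal)) + ω ^ ζ * ((c + 1 : ℕ) : Ordinal) :=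
            (add_le_add_left hlt.le _).trans_lt (add_lt_add_right hα _)
        _ = ω ^ ζ * (m + ((c + n + 2 : ℕ) : Ordinal)) := by
            rw [← mul_add, add_assoc, ← Nat.cast_add, show n + 1 + (c + 1) = c + n + 2 by ring]
    have hup : z.1 < ω ^ ζ * (m + ω) := by
      calc z.1 < ω ^ ζ * (m + ((c + n + 2 : ℕ) : Ordinal)) + ω ^ ζ * ((c + 1 : ℕ) : Ordinal) :=
            h2.trans_lt (add_lt_add_right hα _)
        _ = ω ^ ζ * (m + ((c + n + 2 + (c + 1) : ℕ) : Ordinal)) := by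
            rw [← mul_add, add_assoc, ← Nat.cast_add]
        _ ≤ ω ^ ζ * (m + ω) := by gcongr; exact (natCast_lt_omega0 _).le
    have hlow' : m + ((n + 1 : ℕ) : Ordinal) ≤ z.1 / ω ^ ζ := (mul_le_iff_le_div hζ0).1 hlow
    have hup' : z.1 / ω ^ ζ < m + ω := (lt_mul_iff_div_lt hζ0).1 hup
    obtain ⟨d, hd⟩ := exists_add_of_le (le_self_add.trans hlow')
    rw [hd] at hlow' hup'
    obtain ⟨j, rfl⟩ := lt_omega0.1 (lt_of_add_lt_add_left hup')
    obtain ⟨k, hk⟩ := lt_omega0.1 (mod_lt m omega0_ne_zero)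
    have hj : n + 1 ≤ j := by exact_mod_cast le_of_add_le_add_left hlow'
    have hmod : z.1 / ω ^ ζ % ω = ((k + j : ℕ) : Ordinal) := by
      rw [hd, ← div_add_mod m ω, hk, add_assoc, ← Nat.cast_add, mul_add_mod_self,
        natCast_mod_omega0]
    have hn : ((k + j : ℕ) : Ordinal) ≤ n := hmod ▸ hz ζ
    have hn : k + j ≤ n := by exact_mod_cast hn
    omega
  · refine (lt_mul_div_add x.1 hζ0).le.trans (le_trans ?_ le_self_add)
    rw [← hm, ← mul_add_one]
    refine mul_le_mul_right (add_le_add_right ?_ m) _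
    exact_mod_cast (by omega : 1 ≤ c + n + 2)

theorem cores_eq (hκ : ℵ₀ ≤ κ) : (cardinalBallean κ hκ).cores = ℵ₀ := by
  have hcov : ⋃₀ range (boundedCoeff κ) = Set.univ := eq_univ_of_forall fun z => by
    obtain ⟨n, hn⟩ := exists_forall_div_opow_mod_omega0_le z.1
    exact ⟨_, ⟨n, rfl⟩, hn⟩
  have hsmall : ∀ A ∈ range (boundedCoeff κ), (cardinalBallean κ hκ).IsSmall A := by
    rintro _ ⟨n, rfl⟩
    exact isSmall_boundedCoeff hκ n
  refine le_antisymm ?_ (le_csInf ⟨_, _, hcov, hsmall, rfl⟩ ?_)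
  · refine le_trans (csInf_le' ?_) (countable_range (boundedCoeff κ)).le_aleph0
    exact ⟨_, hcov, hsmall, rfl⟩
  · rintro _ ⟨F, hF, h, rfl⟩
    exact aleph0_le_mk_iff.2 (infinite_coe_iff.2 (Ballean.infinite_of_sUnion_eq_univ hF h))

/-! ### Coverings by thin sets -/

theorem cof_Iio_ord : Order.cof (Iio κ.ord) = lift.{u + 1} κ.ord.cof := by
  rw [Ordinal.cof_Iio, Ordinal.lift_cof]

/-- The initial segments given by a cofinal set are bounded, hence thin. -/
theorem thin_le_cof (hκ : ℵ₀ ≤ κ) :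
    (cardinalBallean κ hκ).thin ≤ lift.{u + 1} κ.ord.cof := by
  obtain ⟨s, hs, hcard⟩ := Order.exists_cof_eq (Iio κ.ord)
  rw [← cof_Iio_ord, ← hcard]
  refine (Ballean.thin_le_mk (F := Iic '' s) (eq_univ_of_forall fun x => ?_) ?_).trans mk_image_le
  · obtain ⟨y, hy, hxy⟩ := hs x
    exact ⟨Iic y, mem_image_of_mem _ hy, hxy⟩
  · rintro _ ⟨y, -, rfl⟩
    exact Ballean.IsBounded.isThin ((isBounded_iff hκ).2 bddAbove_Iic)

/-- Fewer than `cf κ` thin sets are, beyond a common bound `x`, all `α`-separated. Each of them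
then has at most one point in `[x, x + α)`. -/
theorem card_le_of_isThin_covering (hκ : ℵ₀ ≤ κ) {F : Set (Set (Iio κ.ord))}
    (hF : ⋃₀ F = Set.univ) (hthin : ∀ A ∈ F, (cardinalBallean κ hκ).IsThin A)
    (hcof : #F < lift.{u + 1} κ.ord.cof) (α : Iio κ.ord) : lift.{u + 1} α.1.card ≤ #F := by
  have h : ∀ A : F, ∃ b : Iio κ.ord, ∀ a ∈ A.1, ∀ a' ∈ A.1, b < a → b < a' → a ≠ a' →
      (cardinalBallean κ hκ).ball a α ∩ (cardinalBallean κ hκ).ball a' α = ∅ := fun A => by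
    obtain ⟨V, hV, h⟩ := hthin A.1 A.2 α
    obtain ⟨b, hb⟩ := (isBounded_iff hκ).1 hV
    exact ⟨b, fun a ha a' ha' hba hba' => h a ⟨ha, fun hV => (hb hV).not_gt hba⟩
      a' ⟨ha', fun hV => (hb hV).not_gt hba'⟩⟩
  choose b hb using h
  have hnot : ¬ IsCofinal (range b) := fun h => by
    have := (Order.cof_le h).trans mk_range_le
    rw [cof_Iio_ord] at this
    exact this.not_gt hcof
  obtain ⟨x, hx⟩ := not_isCofinal_iff.1 hnot
  have hmem : ∀ y : Iio κ.ord, ∃ A : F, y ∈ A.1 := fun y => by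
    obtain ⟨A, hA, hy⟩ := mem_sUnion.1 (hF ▸ mem_univ y : y ∈ ⋃₀ F)
    exact ⟨⟨A, hA⟩, hy⟩
  choose i hi using hmem
  let p : Iio α.1 → Iio κ.ord := fun δ => ⟨x.1 + δ.1, add_lt_ord hκ x.2 (δ.2.trans α.2)⟩
  have hxp : ∀ δ, x ≤ p δ := fun δ => (le_self_add : x.1 ≤ x.1 + δ.1)
  have hball : ∀ δ, x ∈ (cardinalBallean κ hκ).ball (p δ) α := fun δ =>
    (mem_ball hκ).2 ⟨(show x.1 ≤ (p δ).1 from hxp δ).trans le_self_add,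
      add_le_add_right (le_of_lt δ.2) _⟩
  rw [← Cardinal.mk_Iio_ordinal]
  refine mk_le_of_injective (f := fun δ => i (p δ)) fun δ δ' hδ => ?_
  have hδ : i (p δ) = i (p δ') := hδ
  by_contra! hne
  have hpne : p δ ≠ p δ' := fun h =>
    hne (Subtype.ext (add_left_cancel (congrArg Subtype.val h : x.1 + δ.1 = x.1 + δ'.1)))
  have hlt : ∀ δ'', b (i (p δ)) < p δ'' := fun δ'' => (hx _ ⟨_, rfl⟩).trans_le (hxp δ'')
  have hdisj := hb (i (p δ)) (p δ) (hi _) (p δ') (hδ ▸ hi (p δ')) (hlt δ) (hlt δ') hpne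
  exact hdisj.subset ⟨hball δ, hball δ'⟩

theorem thin_eq_cof (hκ : ℵ₀ ≤ κ) (hlim : Order.IsSuccLimit κ) :
    (cardinalBallean κ hκ).thin = lift.{u + 1} κ.ord.cof := by
  refine le_antisymm (thin_le_cof hκ) (Ballean.le_thin fun F hF hthin => ?_)
  by_contra! hlt
  obtain ⟨c, hc, hcF⟩ := lt_lift_iff.1 hlt
  have hsucc : Order.succ c < κ := hlim.succ_lt (hc.trans_le (cof_ord_le κ))
  have := card_le_of_isThin_covering hκ hF hthin hlt ⟨(Order.succ c).ord, ord_lt_ord.2 hsucc⟩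
  rw [card_ord, ← hcF, Cardinal.lift_le] at this
  exact this.not_gt (Order.lt_succ c)

/-- Points from different intervals `[ω ^ μ, ω ^ (μ + 1))` are far apart: `ω ^ (μ + 1)` is closed
under addition. -/
theorem isThin_of_injOn_log (hκ : ℵ₀ ≤ κ) {A : Set (Iio κ.ord)}
    (hA : InjOn (fun x : Iio κ.ord => log ω x.1) A) : (cardinalBallean κ hκ).IsThin A := by
  intro α
  refine ⟨Iic α, (isBounded_iff hκ).2 bddAbove_Iic, ?_⟩
  have key : ∀ x ∈ A \ Iic α, ∀ y ∈ A \ Iic α, log ω x.1 < log ω y.1 →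
      (cardinalBallean κ hκ).ball x α ∩ (cardinalBallean κ hκ).ball y α = ∅ := by
    intro x hx y hy hlog
    refine eq_empty_of_forall_notMem fun z hz => ?_
    have hxz := ((mem_ball hκ).1 hz.1).1
    have hyz := ((mem_ball hκ).1 hz.2).2
    have hxα : α.1 < x.1 := not_le.1 fun h => hx.2 h
    have hprin := isPrincipal_add_omega0_opow (Order.succ (log ω x.1))
    have hxlt : x.1 < ω ^ Order.succ (log ω x.1) := lt_opow_succ_log_self one_lt_omega0 _
    have hy0 : y.1 ≠ 0 := (zero_le.trans_lt (not_le.1 fun h => hy.2 h : α.1 < y.1)).ne'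
    have hylow : ω ^ Order.succ (log ω x.1) ≤ y.1 :=
      (opow_le_opow_right omega0_pos (Order.succ_le_of_lt hlog)).trans (opow_log_le_self ω hy0)
    have hz : z.1 < ω ^ Order.succ (log ω x.1) :=
      hxz.trans_lt (hprin hxlt (hxα.trans hxlt))
    exact (hylow.trans hyz).not_gt (hprin hz (hxα.trans hxlt))
  intro x hx y hy hne
  rcases lt_trichotomy (log ω x.1) (log ω y.1) with h | h | h
  · exact key x hx y hy h
  · exact absurd (hA hx.1 hy.1 h) hne
  · rw [inter_comm]
    exact key y hy x hx h

/-- Each interval `[ω ^ μ, ω ^ (μ + 1))` below `κ⁺` has at most `κ` points; after enumerating each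
of them by `κ`, the points with a given index form a thin set. -/
theorem thin_succ_le (hκ : ℵ₀ ≤ κ) :
    (cardinalBallean (Order.succ κ) (hκ.trans (Order.le_succ κ))).thin ≤ lift.{u + 1} κ := by
  set hκ' := hκ.trans (Order.le_succ κ)
  have hω : ω < (Order.succ κ).ord := by
    rw [← ord_aleph0]
    exact ord_lt_ord.2 (hκ.trans_lt (Order.lt_succ κ))
  have hemb : ∀ μ : Iio (Order.succ κ).ord, Nonempty (Iio (ω ^ (μ.1 + 1)) ↪ Iio κ.ord) := by
    intro μ
    have h : ω ^ (μ.1 + 1) < (Order.succ κ).ord :=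
      opow_lt_ord hκ' hω (add_one_lt_ord hκ' μ.2)
    have h' : (ω ^ (μ.1 + 1)).card ≤ κ := Order.lt_succ_iff.1 (lt_ord.1 h)
    rw [← Cardinal.le_def, Cardinal.mk_Iio_ordinal, mk_Iio_ord]
    exact Cardinal.lift_le.2 h'
  have e := fun μ => (hemb μ).some
  -- since `log ω 0 = 0`, the point `0` belongs to the interval with index `0`
  let l : Iio (Order.succ κ).ord → Iio (Order.succ κ).ord := fun x =>
    ⟨log ω x.1, (log_le_self ω x.1).trans_lt x.2⟩
  let idx : Iio (Order.succ κ).ord → Iio κ.ord := fun x =>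
    e (l x) ⟨x.1, lt_opow_succ_log_self one_lt_omega0 x.1⟩
  have hidx : ∀ x y, l x = l y → idx x = idx y → x = y := by
    intro x y hl hi
    have h : ∀ (μ ν : Iio (Order.succ κ).ord) (a : Iio (ω ^ (μ.1 + 1))) (b : Iio (ω ^ (ν.1 + 1))),
        μ = ν → e μ a = e ν b → a.1 = b.1 := by
      rintro μ _ a b rfl hab
      rw [(e μ).injective hab]
    exact Subtype.ext (h _ _ _ _ hl hi)
  refine (Ballean.thin_le_mk (F := range fun i => idx ⁻¹' {i})
    (eq_univ_of_forall fun x => ⟨_, ⟨idx x, rfl⟩, rfl⟩) ?_).trans ?_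
  · rintro _ ⟨i, rfl⟩
    exact isThin_of_injOn_log hκ' fun x hx y hy h =>
      hidx x y (Subtype.ext h) (Eq.trans hx (Eq.symm hy))
  · exact mk_range_le.trans mk_Iio_ord.le

theorem thin_succ_eq (hκ : ℵ₀ ≤ κ) :
    (cardinalBallean (Order.succ κ) (hκ.trans (Order.le_succ κ))).thin = lift.{u + 1} κ := by
  refine le_antisymm (thin_succ_le hκ) (Ballean.le_thin fun F hF hthin => ?_)
  by_contra! hlt
  have hcof : #F < lift.{u + 1} (Order.succ κ).ord.cof := by
    rw [(isRegular_succ hκ).cof_ord]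
    exact hlt.trans (Cardinal.lift_lt.2 (Order.lt_succ κ))
  have := card_le_of_isThin_covering _ hF hthin hcof ⟨κ.ord, ord_lt_ord.2 (Order.lt_succ κ)⟩
  rw [card_ord] at this
  exact this.not_gt hlt

end CardinalBallean

theorem theorem4 (κ : Cardinal.{u}) (hκ : ℵ₀ ≤ κ) :
    ((cardinalBallean κ hκ).den = Cardinal.lift.{u + 1} κ ∧
      (cardinalBallean κ hκ).spread = Cardinal.lift.{u + 1} κ) ∧
    ((cardinalBallean κ hκ).res = Cardinal.lift.{u + 1} κ ∧
      ∃ F : Set (Set (Set.Iio κ.ord)), Setoid.IsPartition F ∧ #F = Cardinal.lift.{u + 1} κ ∧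
        ∀ L ∈ F, (cardinalBallean κ hκ).IsLarge L) ∧
    (cardinalBallean κ hκ).cores = ℵ₀ ∧
    ((cardinalBallean κ hκ).thick = Cardinal.lift.{u + 1} κ ∧
      ∃ F : Set (Set (Set.Iio κ.ord)), Setoid.IsPartition F ∧ #F = Cardinal.lift.{u + 1} κ ∧
        ∀ T ∈ F, (cardinalBallean κ hκ).IsThick T) ∧
    ((Order.IsSuccLimit κ → (cardinalBallean κ hκ).thin = Cardinal.lift.{u + 1} κ.ord.cof) ∧
      (cardinalBallean (Order.succ κ) (hκ.trans (Order.le_succ κ))).thin =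
        Cardinal.lift.{u + 1} κ) := by
  have hmk : #(Set.Iio κ.ord) = Cardinal.lift.{u + 1} κ := CardinalBallean.mk_Iio_ord
  rw [← hmk]
  refine ⟨⟨?_, ?_⟩, ⟨CardinalBallean.res_eq hκ, CardinalBallean.exists_isPartition_isLarge hκ⟩,
    CardinalBallean.cores_eq hκ,
    ⟨CardinalBallean.thick_eq hκ, CardinalBallean.exists_isPartition_isThick hκ⟩,
    CardinalBallean.thin_eq_cof hκ, ?_⟩
  · rw [hmk, CardinalBallean.den_eq hκ]
  · rw [hmk, CardinalBallean.spread_eq hκ]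
  · rw [hmk, CardinalBallean.thin_succ_eq hκ]
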